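/- For a compact Hausdorff space $K$ let $C(K)$ be the Banach space of continuous real-valued functions on $K$ with the maximum norm. A linear isometry (into) $T\colon X\to Y$ between real Banach spaces is called a U-embedding if for every $x^*\in X^*$ with $\|x^*\|=1$ there is exactly one $y^*\in Y^*$ with $y^*\circ T=x^*$ and $\|y^*\|=\|x^*\|$. If $h\colon K\to S$ is a topological embedding between compact Hausdorff spaces, a bounded linear operator $T\colon C(K)\to C(S)$ is called a linear extension operator for $h$ if $(Tf)(h(k))=f(k)$ for all $f\in C(K)$ and $k\in K$. **Theorem.** Let $K$ and $S$ be compact Hausdorff spaces with $K$ nonempty. The following conditions are equivalent: 1. There exists a U-embedding $T\colon C(K)\to C(S)$. 2. There exists a topological embedding (homeomorphism onto its image) $h\colon K\to S$ such that $h(K)$ is a $G_\delta$ subset of $S$ and $h$ admits a linear extension operator $T\colon C(K)\to C(S)$ with $\|T\|=1$. -/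

import Mathlib

open Topology

/-- `y'` is a Hahn–Banach extension of `x'` through the linear isometry `T : X → Y`:
`T^* y' = x'` and `‖y'‖ = ‖x'‖`. -/
def IsHahnBanachExtension {X Y : Type*} [NormedAddCommGroup X] [NormedSpace ℝ X]
    [NormedAddCommGroup Y] [NormedSpace ℝ Y] (T : X →ₗᵢ[ℝ] Y)
    (x' : StrongDual ℝ X) (y' : StrongDual ℝ Y) : Prop :=
  y'.comp T.toContinuousLinearMap = x' ∧ ‖y'‖ = ‖x'‖

/-- A linear isometry `T` from `X` into `Y` is a U-embedding if every functional in the unit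
sphere of the dual of `X` has a unique Hahn–Banach extension through `T`. -/
def IsUEmbedding {X Y : Type*} [NormedAddCommGroup X] [NormedSpace ℝ X]
    [NormedAddCommGroup Y] [NormedSpace ℝ Y] (T : X →ₗᵢ[ℝ] Y) : Prop :=
  ∀ x' : StrongDual ℝ X, ‖x'‖ = 1 → ∃! y' : StrongDual ℝ Y, IsHahnBanachExtension T x' y'

/-- The Dirac functional `δ_k : f ↦ f k` on `C(K)`. -/
noncomputable def diracFunctional {K : Type*} [TopologicalSpace K] [CompactSpace K] (k : K) :
    StrongDual ℝ C(K, ℝ) :=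
  ContinuousMap.evalCLM ℝ k

/-- The map `F_T = T^* ∘ δ : S → X^*` associated with an operator `T : X → C(S)`. -/
noncomputable def associatedMap {X S : Type*} [NormedAddCommGroup X] [NormedSpace ℝ X]
    [TopologicalSpace S] [CompactSpace S] (T : X →L[ℝ] C(S, ℝ)) (s : S) : StrongDual ℝ X :=
  (diracFunctional s).comp T

/-- `T : C(K) → C(S)` is a linear extension operator for `h : K → S` if `F_T ∘ h = δ`, that is,
`T f (h k) = f k` for all `f` and `k`. -/
def IsLinearExtensionOperator {K S : Type*} [TopologicalSpace K] [CompactSpace K]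
    [TopologicalSpace S] [CompactSpace S] (h : K → S) (T : C(K, ℝ) →L[ℝ] C(S, ℝ)) : Prop :=
  associatedMap T ∘ h = diracFunctional

/-! Holsztyński's theorem (`exists_forall_mul_apply_eq`) represents each `δ_k` as a signed Dirac
functional on `C(S)` pulled back through `T`. Uniqueness of Hahn–Banach extensions makes the
representing point unique, which gives a map `h`, and it confines the points `s` with `‖T^* δ_s‖ =
1` to the image of `h`; such points form a `Gδ` set. Multiplying `T` by `T 1` removes the sign and
leaves an extension operator. Conversely, the `Gδ` condition gives a continuous `g` with `0 ≤ g ≤ 1`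
and `{g = 1} = h(K)`. For `T f = g * E f` the factor `g` leaves room off `h(K)`, so every norm
preserving extension is carried by `h(K)`, where it is determined. -/

theorem ContinuousMap.eq_of_forall_apply_eq {X : Type*} [TopologicalSpace X] [CompactSpace X]
    [T2Space X] {x y : X} (h : ∀ g : C(X, ℝ), g x = g y) : x = y := by
  by_contra hxy
  obtain ⟨f, hf0, hf1, -⟩ := exists_continuous_zero_one_of_isClosed
    (isClosed_singleton (x := x)) (isClosed_singleton (x := y)) (by simpa using hxy)
  have h0 : f x = 0 := hf0 rfl
  have h1 : f y = 1 := hf1 rfl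
  have := h f
  simp [h0, h1] at this

/-- A functional lifting `x'` through an isometry is a Hahn–Banach extension as soon as its norm
does not exceed that of `x'`. -/
theorem isHahnBanachExtension_of_norm_le {X Y : Type*} [NormedAddCommGroup X] [NormedSpace ℝ X]
    [NormedAddCommGroup Y] [NormedSpace ℝ Y] {T : X →ₗᵢ[ℝ] Y} {x' : StrongDual ℝ X}
    {y' : StrongDual ℝ Y} (h : ∀ x, y' (T x) = x' x) (hle : ‖y'‖ ≤ ‖x'‖) :
    IsHahnBanachExtension T x' y' := by
  refine ⟨ContinuousLinearMap.ext h, le_antisymm hle ?_⟩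
  refine ContinuousLinearMap.opNorm_le_bound _ (norm_nonneg _) fun x => ?_
  rw [← h x, ← T.norm_map x]
  exact y'.le_opNorm _

theorem norm_diracFunctional_le {K : Type*} [TopologicalSpace K] [CompactSpace K] (k : K) :
    ‖diracFunctional k‖ ≤ 1 := by
  refine ContinuousLinearMap.opNorm_le_bound _ zero_le_one fun f => ?_
  rw [one_mul]
  exact f.norm_coe_le_norm k

theorem norm_diracFunctional {K : Type*} [TopologicalSpace K] [CompactSpace K] (k : K) :
    ‖diracFunctional k‖ = 1 := by
  refine le_antisymm (norm_diracFunctional_le k) ?_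
  have : Nonempty K := ⟨k⟩
  have h := (diracFunctional k).le_opNorm (1 : C(K, ℝ))
  have h1 : diracFunctional k (1 : C(K, ℝ)) = 1 := rfl
  rw [h1] at h
  simpa using h

/-! ### Holsztyński's theorem. -/

/-- A functional on `C(K)` that is `1` on all functions of the unit ball attaining the value `1` at
`k` is the evaluation at `k`. -/
theorem eq_apply_of_eq_one_of_peak {K : Type*} [TopologicalSpace K] [CompactSpace K] {k : K}
    (φ : C(K, ℝ) →ₗ[ℝ] ℝ) (hφ : ∀ f : C(K, ℝ), ‖f‖ ≤ 1 → f k = 1 → φ f = 1) (g : C(K, ℝ)) :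
    φ g = g k := by
  have hone : φ 1 = 1 := hφ 1 ((ContinuousMap.norm_le _ zero_le_one).2 (by simp)) rfl
  have hsmall : ∀ g : C(K, ℝ), ‖g‖ ≤ 1 → g k = 0 → φ g = 0 := by
    intro g hg hgk
    have hb : ∀ x, |g x| ≤ 1 := fun x => (g.norm_coe_le_norm x).trans hg
    -- Both `1 - |g|` and `1 - |g| + g` lie in the unit ball and peak at `k`; their difference is
    -- `g`.
    have h1 := hφ (1 - |g|) ((ContinuousMap.norm_le _ zero_le_one).2 fun x => by
      have := hb x
      have := abs_nonneg (g x)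
      simp only [ContinuousMap.sub_apply, ContinuousMap.one_apply, ContinuousMap.abs_apply,
        Real.norm_eq_abs]
      rw [abs_le]; constructor <;> linarith) (by simp [hgk])
    have h2 := hφ (1 - |g| + g) ((ContinuousMap.norm_le _ zero_le_one).2 fun x => by
      have := hb x
      have := neg_abs_le (g x)
      have := le_abs_self (g x)
      simp only [ContinuousMap.add_apply, ContinuousMap.sub_apply, ContinuousMap.one_apply,
        ContinuousMap.abs_apply, Real.norm_eq_abs]
      rw [abs_le]; constructor <;> linarith) (by simp [hgk])
    rw [map_add, h1] at h2
    linarith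
  have hzero : ∀ g : C(K, ℝ), g k = 0 → φ g = 0 := by
    intro g hgk
    have hpos : 0 < ‖g‖ + 1 := by positivity
    have h := hsmall ((‖g‖ + 1)⁻¹ • g) (by
      rw [norm_smul, Real.norm_of_nonneg (by positivity), inv_mul_le_one₀ hpos]
      linarith) (by simp [hgk])
    rw [map_smul, smul_eq_mul] at h
    exact (mul_eq_zero.1 h).resolve_left (inv_ne_zero hpos.ne')
  have h := hzero (g - g k • 1) (by simp)
  rw [map_sub, map_smul, hone] at h
  simp only [smul_eq_mul, mul_one] at h
  linarith

/-- Holsztyński's theorem: for an isometry `T : C(K) → C(S)`, every evaluation at a point of `K` is,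
up to the sign `T 1 s`, of the form `f ↦ T f s`. -/
theorem exists_forall_mul_apply_eq {K S : Type*} [TopologicalSpace K] [CompactSpace K]
    [TopologicalSpace S] [CompactSpace S] (T : C(K, ℝ) →ₗᵢ[ℝ] C(S, ℝ)) (k : K) :
    ∃ s, ∀ g, T 1 s * T g s = g k := by
  have hT : ∀ f : C(K, ℝ), ‖f‖ ≤ 1 → ∀ s, |T f s| ≤ 1 := fun f hf s =>
    ((T f).norm_coe_le_norm s).trans ((T.norm_map f).trans_le hf)
  have h1 : ‖(1 : C(K, ℝ))‖ ≤ 1 := (ContinuousMap.norm_le _ zero_le_one).2 (by simp)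
  let P := {f : C(K, ℝ) // ‖f‖ ≤ 1 ∧ f k = 1}
  have key : (Set.univ ∩ ⋂ f : P, {s : S | T 1 s * T f.1 s = 1}).Nonempty := by
    refine isCompact_univ.inter_iInter_nonempty _
      (fun f => isClosed_eq (by fun_prop) continuous_const) fun u => ?_
    -- At a point where `|T F|` reaches `1 + u.card`, each of the `1 + u.card` summands has modulus
    -- at most `1`, so all equal the same sign `e`. The extra summand `1` identifies `e` with `T 1
    -- s`.
    set F : C(K, ℝ) := 1 + ∑ f ∈ u, f.1 with hF
    have hFk : F k = 1 + u.card := by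
      rw [hF, ContinuousMap.add_apply, ContinuousMap.sum_apply, Finset.sum_congr rfl
        fun f _ => f.2.2]
      simp
    have hnorm : (1 + u.card : ℝ) ≤ ‖T F‖ := by
      rw [T.norm_map, ← hFk]
      exact F.apply_le_norm k
    obtain ⟨s, hs⟩ : ∃ s, (1 + u.card : ℝ) ≤ |T F s| := by
      have hS : Nonempty S := by
        by_contra hS
        rw [not_nonempty_iff] at hS
        have : T F = 0 := ContinuousMap.ext fun s => hS.elim s
        rw [this, norm_zero] at hnorm
        have : (0 : ℝ) ≤ u.card := Nat.cast_nonneg _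
        linarith
      by_contra! hcon
      exact absurd ((ContinuousMap.norm_lt_iff_of_nonempty _).2 hcon) hnorm.not_gt
    obtain ⟨e, he, hes⟩ : ∃ e : ℝ, (e = 1 ∨ e = -1) ∧ |T F s| = e * T F s := by
      rcases abs_choice (T F s) with h | h
      · exact ⟨1, .inl rfl, by rw [h, one_mul]⟩
      · exact ⟨-1, .inr rfl, by rw [h]; ring⟩
    have hle : ∀ f : C(K, ℝ), ‖f‖ ≤ 1 → e * T f s ≤ 1 := by
      intro f hf
      have := abs_le.1 (hT f hf s)
      rcases he with rfl | rfl <;> linarith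
    have hsum : e * T F s = e * T 1 s + ∑ f ∈ u, e * T f.1 s := by
      rw [hF, map_add, map_sum, ContinuousMap.add_apply, ContinuousMap.sum_apply, mul_add,
        Finset.mul_sum]
    rw [hes, hsum] at hs
    have hub : ∑ f ∈ u, e * T f.1 s ≤ u.card := by
      calc _ ≤ ∑ f ∈ u, (1 : ℝ) := Finset.sum_le_sum fun f _ => hle _ f.2.1
        _ = _ := by simp
    have he1 : e * T 1 s = 1 := le_antisymm (hle 1 h1) (by linarith)
    refine ⟨s, Set.mem_univ s, Set.mem_iInter₂.2 fun f hf => ?_⟩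
    have hef : e * T f.1 s = 1 := by
      have hall := (Finset.sum_eq_sum_iff_of_le (s := u) (f := fun f : P => e * T f.1 s)
        (g := fun _ => (1 : ℝ)) fun f _ => hle _ f.2.1).1 (by
          have := hle 1 h1
          refine le_antisymm (by simpa using hub) ?_
          simp only [Finset.sum_const, nsmul_eq_mul, mul_one]
          linarith)
      exact hall f hf
    change T 1 s * T f.1 s = 1
    rcases he with rfl | rfl <;> nlinarith
  obtain ⟨s, -, hs⟩ := key
  refine ⟨s, eq_apply_of_eq_one_of_peak
    ((T 1 s • ((diracFunctional s).comp T.toContinuousLinearMap)).toLinearMap) fun f hf hk => ?_⟩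
  exact Set.mem_iInter.1 hs ⟨f, hf, hk⟩

/-! ### From a U-embedding to an extension operator. -/

section UEmbedding

variable {K S : Type*} [TopologicalSpace K] [CompactSpace K]
  [TopologicalSpace S] [CompactSpace S] [T2Space S]

/-- The signed Dirac functionals at `s` and `t` are both Hahn–Banach extensions of `δ_k`, hence
equal. -/
theorem IsUEmbedding.eq_of_forall_mul_apply_eq {T : C(K, ℝ) →ₗᵢ[ℝ] C(S, ℝ)} (hT : IsUEmbedding T)
    {k : K} {s t : S} (hs : ∀ g, T 1 s * T g s = g k) (ht : ∀ g, T 1 t * T g t = g k) : s = t := by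
  have aux : ∀ {r : S}, (∀ g, T 1 r * T g r = g k) →
      IsHahnBanachExtension T (diracFunctional k) (T 1 r • diracFunctional r) := by
    intro r hr
    refine isHahnBanachExtension_of_norm_le hr ?_
    have h1 : |T 1 r| = 1 := by
      rw [← pow_eq_one_iff_of_nonneg (abs_nonneg _) two_ne_zero, sq_abs, sq, hr]; rfl
    rw [norm_smul, Real.norm_eq_abs, h1, one_mul, norm_diracFunctional k]
    exact norm_diracFunctional_le r
  have heq := (hT _ (norm_diracFunctional k)).unique (aux hs) (aux ht)
  have happ : ∀ u : C(S, ℝ), T 1 s * u s = T 1 t * u t := fun u => DFunLike.congr_fun heq u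
  have hst : T 1 s = T 1 t := by simpa using happ 1
  have hne : T 1 s ≠ 0 := fun h0 => by simpa [h0] using hs 1
  refine ContinuousMap.eq_of_forall_apply_eq fun u => mul_left_cancel₀ hne ?_
  rw [happ u, hst]

/-- The points of `S` carrying the evaluations of `K` form a `Gδ` set, namely the set on which
`T^* ∘ δ` has norm one. -/
theorem IsUEmbedding.isGδ_range {T : C(K, ℝ) →ₗᵢ[ℝ] C(S, ℝ)} (hT : IsUEmbedding T)
    {h : C(K, S)} (hh : ∀ k g, T 1 (h k) * T g (h k) = g k) : IsGδ (Set.range h) := by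
  have hT1 : ∀ k, |T 1 (h k)| = 1 := fun k => by
    rw [← pow_eq_one_iff_of_nonneg (abs_nonneg _) two_ne_zero, sq_abs, sq, hh]; rfl
  have h1 : ‖(1 : C(K, ℝ))‖ ≤ 1 := (ContinuousMap.norm_le _ zero_le_one).2 (by simp)
  have hle : ∀ s, ‖(diracFunctional s).comp T.toContinuousLinearMap‖ ≤ 1 := fun s =>
    ContinuousLinearMap.opNorm_le_bound _ zero_le_one fun f => by
      rw [one_mul, ← T.norm_map f]
      exact (T f).norm_coe_le_norm s
  have heq : Set.range h =
      ⋂ n : ℕ, {s | ∃ f : C(K, ℝ), ‖f‖ ≤ 1 ∧ 1 - 1 / ((n : ℝ) + 1) < |T f s|} := by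
    refine Set.Subset.antisymm ?_ fun s hs => ?_
    · rintro _ ⟨k, rfl⟩
      refine Set.mem_iInter.2 fun n => ⟨1, h1, ?_⟩
      rw [hT1 k]
      have : (0 : ℝ) < 1 / ((n : ℝ) + 1) := by positivity
      linarith
    set μ : StrongDual ℝ C(K, ℝ) := (diracFunctional s).comp T.toContinuousLinearMap with hμ
    have hμ1 : ‖μ‖ = 1 := by
      refine le_antisymm (hle s) (le_of_forall_pos_lt_add fun ε hε => ?_)
      obtain ⟨n, hn⟩ := exists_nat_one_div_lt hε
      obtain ⟨f, hf, hfs⟩ := Set.mem_iInter.1 hs n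
      have : |T f s| ≤ ‖μ‖ := μ.unit_le_opNorm f hf
      linarith
    -- `J` is a contractive left inverse of `T`, so `μ.comp J` extends `μ` with the same norm, as
    -- does `δ_s`. But `μ.comp J` only sees values on the range of `h`.
    let J : C(S, ℝ) →L[ℝ] C(K, ℝ) :=
      LinearMap.mkContinuous
        { toFun := fun u => ((T 1).comp h) * u.comp h
          map_add' := fun u v => by ext; simp [mul_add]
          map_smul' := fun c u => by ext; simp } 1 fun u => by
            rw [one_mul]
            refine (ContinuousMap.norm_le _ (norm_nonneg _)).2 fun k => ?_
            change |T 1 (h k) * u (h k)| ≤ ‖u‖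
            rw [abs_mul, hT1, one_mul]
            exact u.norm_coe_le_norm _
    have hJ : ‖J‖ ≤ 1 := LinearMap.mkContinuous_norm_le _ zero_le_one _
    have hext₁ : IsHahnBanachExtension T μ (diracFunctional s) :=
      isHahnBanachExtension_of_norm_le (fun _ => rfl) (hμ1 ▸ norm_diracFunctional_le s)
    have hext₂ : IsHahnBanachExtension T μ (μ.comp J) := by
      refine isHahnBanachExtension_of_norm_le (fun f => ?_) ?_
      · exact congrArg μ (ContinuousMap.ext fun k => hh k f)
      · exact (μ.opNorm_comp_le J).trans (mul_le_of_le_one_right (norm_nonneg _) hJ)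
    have hsJ := (hT μ hμ1).unique hext₁ hext₂
    by_contra hsr
    obtain ⟨u, hu0, hu1, -⟩ := exists_continuous_zero_one_of_isClosed
      (isCompact_range h.continuous).isClosed (isClosed_singleton (x := s)) (by simpa using hsr)
    have hu : u s = μ (J u) := DFunLike.congr_fun hsJ u
    have hJu : J u = 0 := ContinuousMap.ext fun k => by
      change T 1 (h k) * u (h k) = 0
      rw [hu0 ⟨k, rfl⟩]; simp
    rw [hJu, map_zero, hu1 rfl] at hu
    exact one_ne_zero hu
  rw [heq]
  refine IsGδ.iInter_of_isOpen fun n => ?_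
  simp only [Set.ofPred_exists]
  refine isOpen_iUnion fun f => ?_
  by_cases hf : ‖f‖ ≤ 1
  · simp only [hf, true_and]
    exact isOpen_lt continuous_const (by fun_prop)
  · simp [hf]

theorem IsUEmbedding.exists_extensionOperator [T2Space K] [Nonempty K] {T : C(K, ℝ) →ₗᵢ[ℝ] C(S, ℝ)}
    (hT : IsUEmbedding T) :
    ∃ h : K → S, IsEmbedding h ∧ IsGδ (Set.range h) ∧
      ∃ T : C(K, ℝ) →L[ℝ] C(S, ℝ), IsLinearExtensionOperator h T ∧ ‖T‖ = 1 := by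
  choose h hh using exists_forall_mul_apply_eq T
  have hcl : IsClosed {p : K × S | ∀ g, T 1 p.2 * T g p.2 = g p.1} := by
    simp only [Set.ofPred_forall]
    exact isClosed_iInter fun g => isClosed_eq (by fun_prop) (by fun_prop)
  have hcont : Continuous h := by
    refine continuous_iff_isClosed.2 fun C hC => ?_
    -- By uniqueness the closed relation `hcl` is the graph of `h`, and projection along the compact
    -- space `S` is closed.
    convert isClosedMap_fst_of_compactSpace _ (hcl.inter (hC.preimage continuous_snd)) using 1
    ext k
    constructor
    · exact fun hk => ⟨(k, h k), ⟨hh k, hk⟩, rfl⟩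
    · rintro ⟨⟨k, s⟩, ⟨h1, h2⟩, rfl⟩
      have : h k = s := hT.eq_of_forall_mul_apply_eq (hh k) h1
      exact this ▸ h2
  have hinj : Function.Injective h := fun k l hkl =>
    ContinuousMap.eq_of_forall_apply_eq fun g => by rw [← hh k, ← hh l, hkl]
  refine ⟨h, (hcont.isClosedEmbedding hinj).isEmbedding, hT.isGδ_range (h := ⟨h, hcont⟩) hh,
    (ContinuousLinearMap.mul ℝ _ (T 1)).comp T.toContinuousLinearMap, ?_, ?_⟩
  · exact funext fun k => ContinuousLinearMap.ext (hh k)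
  · have h1 : ‖(1 : C(K, ℝ))‖ = 1 := norm_one
    refine le_antisymm (ContinuousLinearMap.opNorm_le_bound _ zero_le_one fun f => ?_) ?_
    · change ‖T 1 * T f‖ ≤ _
      refine (norm_mul_le _ _).trans ?_
      rw [T.norm_map, T.norm_map, h1]
    · refine le_trans ?_ (ContinuousLinearMap.unit_le_opNorm _ (1 : C(K, ℝ)) h1.le)
      obtain ⟨k⟩ := ‹Nonempty K›
      refine le_trans ?_ (ContinuousMap.norm_coe_le_norm _ (h k))
      change 1 ≤ ‖T 1 (h k) * T 1 (h k)‖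
      rw [hh]; simp

end UEmbedding

/-! ### From an extension operator to a U-embedding. -/

/-- Suppose that every `T f` with `‖f‖ ≤ 1` is dominated by `g ≤ 1`. A norm preserving extension `y'`
of a functional through `T` vanishes on functions dominated by a multiple of `1 - g`. -/
theorem IsHahnBanachExtension.eq_zero_of_abs_le {X S : Type*} [NormedAddCommGroup X]
    [NormedSpace ℝ X] [TopologicalSpace S] [CompactSpace S] {T : X →ₗᵢ[ℝ] C(S, ℝ)}
    {x' : StrongDual ℝ X} {y' : StrongDual ℝ C(S, ℝ)} (hy : IsHahnBanachExtension T x' y')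
    {g : C(S, ℝ)} (hg : ∀ f, ‖f‖ ≤ 1 → ∀ s, |T f s| ≤ g s) {v : C(S, ℝ)} {c : ℝ}
    (hv : ∀ s, |v s| ≤ c * (1 - g s)) (hg1 : ∀ s, g s ≤ 1) : y' v = 0 := by
  wlog hc : 0 < c generalizing c
  · exact this (c := 1) (fun s => (hv s).trans (by nlinarith [hg1 s])) one_pos
  wlog hpos : 0 ≤ y' v generalizing v
  · have := this (v := -v) (fun s => by simpa using hv s) (by rw [map_neg]; linarith)
    simpa using this
  -- Since `|T f| ≤ g` and `c⁻¹ * |v| ≤ 1 - g`, the sum `T f + c⁻¹ • v` stays in the unit ball. As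
  -- `x' f` comes arbitrarily close to `‖x'‖`, no room is left for `y' v > 0`.
  have key : ∀ f : X, ‖f‖ ≤ 1 → x' f + c⁻¹ * y' v ≤ ‖x'‖ := by
    intro f hf
    have hnorm : ‖T f + c⁻¹ • v‖ ≤ 1 := by
      refine (ContinuousMap.norm_le _ zero_le_one).2 fun s => ?_
      have h1 := hg f hf s
      have h2 : c⁻¹ * |v s| ≤ 1 - g s := by
        rw [inv_mul_le_iff₀ hc]; exact hv s
      calc |T f s + c⁻¹ * v s| ≤ |T f s| + |c⁻¹ * v s| := abs_add_le _ _
        _ = |T f s| + c⁻¹ * |v s| := by rw [abs_mul, abs_of_pos (inv_pos.2 hc)]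
        _ ≤ 1 := by linarith
    have h := (le_abs_self _).trans (y'.unit_le_opNorm _ hnorm)
    rw [map_add, map_smul, smul_eq_mul, hy.2] at h
    rwa [← show y' (T f) = x' f from DFunLike.congr_fun hy.1 f]
  have hbound : ‖x'‖ ≤ ‖x'‖ - c⁻¹ * y' v := by
    refine le_of_forall_lt fun r hr => ?_
    obtain ⟨f, hf, hrf⟩ := ContinuousLinearMap.exists_lt_apply_of_lt_opNorm x' hr
    rcases abs_choice (x' f) with h | h
    · rw [Real.norm_eq_abs, h] at hrf
      linarith [key f hf.le]
    · rw [Real.norm_eq_abs, h] at hrf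
      have := key (-f) (by rw [norm_neg]; exact hf.le)
      rw [map_neg] at this
      linarith
  have : c⁻¹ * y' v ≤ 0 := by linarith
  exact le_antisymm (nonpos_of_mul_nonpos_right this (inv_pos.2 hc)) hpos

/-- A bounded functional that vanishes on the functions dominated by a multiple of `1 - g`, where
`g ≤ 1`, vanishes on the functions that are zero on `{g = 1}`. -/
theorem eq_zero_of_forall_abs_le_of_eqOn {S : Type*} [TopologicalSpace S] [CompactSpace S]
    {y' : StrongDual ℝ C(S, ℝ)} {g : C(S, ℝ)} (hg1 : ∀ s, g s ≤ 1)
    (hy : ∀ (v : C(S, ℝ)) (c : ℝ), (∀ s, |v s| ≤ c * (1 - g s)) → y' v = 0)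
    {v : C(S, ℝ)} (hv : ∀ s, g s = 1 → v s = 0) : y' v = 0 := by
  have key : ∀ δ > 0, |y' v| ≤ ‖y'‖ * δ := by
    intro δ hδ
    -- Truncation at height `δ`: `v - w` vanishes where `|v| ≤ δ`, and on the compact set `{δ ≤
    -- |v|}` the function `1 - g` is bounded below by some `m > 0`. Hence `y' v = y' w`, which is
    -- small.
    let w : C(S, ℝ) := ⟨fun s => max (-δ) (min δ (v s)), by fun_prop⟩
    have hw : ‖w‖ ≤ δ := (ContinuousMap.norm_le _ hδ.le).2 fun s =>
      abs_le.2 ⟨le_max_left _ _, max_le (by linarith) (min_le_left _ _)⟩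
    have hwv : ∀ s, |v s| ≤ δ → w s = v s := fun s hs => by
      have := abs_le.1 hs
      change max (-δ) (min δ (v s)) = v s
      rw [min_eq_right this.2, max_eq_right this.1]
    have hvw : ∀ s, |v s - w s| ≤ ‖v‖ + δ := fun s =>
      (abs_sub _ _).trans (add_le_add (v.norm_coe_le_norm s) ((w.norm_coe_le_norm s).trans hw))
    obtain ⟨m, hm, hmg⟩ : ∃ m > 0, ∀ s, δ ≤ |v s| → m ≤ 1 - g s := by
      have hcomp : IsCompact {s | δ ≤ |v s|} :=
        (isClosed_le continuous_const (by fun_prop)).isCompact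
      refine hcomp.exists_forall_le' (a := 0) (f := fun s => 1 - g s) (by fun_prop) fun s hs => ?_
      have hne : g s ≠ 1 := fun h => by
        have : δ ≤ |v s| := hs
        rw [hv s h, abs_zero] at this
        linarith
      exact sub_pos.2 (lt_of_le_of_ne (hg1 s) hne)
    have h0 := hy (v - w) ((‖v‖ + δ) / m) fun s => by
      have hC : 0 ≤ (‖v‖ + δ) / m := by positivity
      rcases le_total |v s| δ with h | h
      · rw [ContinuousMap.sub_apply, hwv s h, sub_self, abs_zero]
        exact mul_nonneg hC (sub_nonneg.2 (hg1 s))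
      · calc |v s - w s| ≤ ‖v‖ + δ := hvw s
          _ = (‖v‖ + δ) / m * m := by field_simp
          _ ≤ _ := mul_le_mul_of_nonneg_left (hmg s h) hC
    rw [map_sub, sub_eq_zero] at h0
    rw [h0]
    exact (y'.le_opNorm w).trans (mul_le_mul_of_nonneg_left hw (norm_nonneg _))
  have hle : |y' v| ≤ 0 := by
    refine le_of_forall_pos_le_add fun ε hε => ?_
    have h := key (ε / (‖y'‖ + 1)) (by positivity)
    have h2 : ‖y'‖ * (ε / (‖y'‖ + 1)) ≤ ε := by
      rw [mul_div_assoc', div_le_iff₀ (by positivity)]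
      nlinarith [norm_nonneg y']
    linarith
  exact abs_nonpos_iff.1 hle

theorem exists_isUEmbedding_of_extensionOperator {K S : Type*} [TopologicalSpace K]
    [CompactSpace K] [TopologicalSpace S] [CompactSpace S] [T2Space S]
    {h : C(K, S)} (hG : IsGδ (Set.range h)) {E : C(K, ℝ) →L[ℝ] C(S, ℝ)}
    (hE : ∀ f k, E f (h k) = f k) (hE1 : ‖E‖ ≤ 1) :
    ∃ T : C(K, ℝ) →ₗᵢ[ℝ] C(S, ℝ), IsUEmbedding T := by
  obtain ⟨g, hg, -, -, hg01⟩ := exists_continuous_one_zero_of_isCompact_of_isGδ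
    (isCompact_range h.continuous) hG isClosed_empty (Set.disjoint_empty _)
  have hgh : ∀ k, g (h k) = 1 := fun k => by
    have : h k ∈ g ⁻¹' {1} := hg ▸ Set.mem_range_self k
    exact this
  have hEb : ∀ f s, |E f s| ≤ ‖f‖ := fun f s =>
    ((E f).norm_coe_le_norm s).trans ((E.le_of_opNorm_le hE1 f).trans_eq (one_mul _))
  have hb : ∀ f s, |g s * E f s| ≤ g s * ‖f‖ := fun f s => by
    rw [abs_mul, abs_of_nonneg (hg01 s).1]
    exact mul_le_mul_of_nonneg_left (hEb f s) (hg01 s).1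
  let T : C(K, ℝ) →ₗᵢ[ℝ] C(S, ℝ) :=
    { toLinearMap := ((ContinuousLinearMap.mul ℝ _ g).comp E).toLinearMap
      norm_map' := fun f => by
        change ‖g * E f‖ = ‖f‖
        refine le_antisymm ((ContinuousMap.norm_le _ (norm_nonneg _)).2 fun s => ?_)
          ((ContinuousMap.norm_le _ (norm_nonneg _)).2 fun k => ?_)
        · exact (hb f s).trans (mul_le_of_le_one_left (norm_nonneg _) (hg01 s).2)
        · have := (g * E f).norm_coe_le_norm (h k)
          rwa [ContinuousMap.mul_apply, hgh, hE, one_mul] at this }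
  have hTh : ∀ f k, T f (h k) = f k := fun f k => by
    change g (h k) * E f (h k) = f k
    rw [hgh, hE, one_mul]
  let R : C(S, ℝ) →L[ℝ] C(K, ℝ) := ContinuousMap.compCLM ℝ ℝ h
  have hR : ‖R‖ ≤ 1 := ContinuousLinearMap.opNorm_le_bound _ zero_le_one fun u => by
    rw [one_mul]
    exact (ContinuousMap.norm_le _ (norm_nonneg _)).2 fun k => u.norm_coe_le_norm (h k)
  refine ⟨T, fun x' _ => ⟨x'.comp R, ?_, fun y' hy => ?_⟩⟩
  · refine isHahnBanachExtension_of_norm_le (fun f => ?_) ?_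
    · exact congrArg x' (ContinuousMap.ext fun k => hTh f k)
    · exact (x'.opNorm_comp_le R).trans (mul_le_of_le_one_right (norm_nonneg _) hR)
  · ext u
    -- `u` and `T (R u)` agree on the range of `h`, which is `{g = 1}`; so `y' u = y' (T (R u)) = x'
    -- (R u)` is forced.
    have h0 : y' (u - T (R u)) = 0 := by
      refine eq_zero_of_forall_abs_le_of_eqOn (g := g) (fun s => (hg01 s).2) (fun v c hv => ?_)
        fun s hs => ?_
      · exact hy.eq_zero_of_abs_le (fun f hf s => (hb f s).trans
          (mul_le_of_le_one_right (hg01 s).1 hf)) hv fun s => (hg01 s).2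
      · obtain ⟨k, rfl⟩ : s ∈ Set.range h := hg ▸ hs
        rw [ContinuousMap.sub_apply, hTh]
        exact sub_self _
    rw [map_sub, sub_eq_zero] at h0
    rw [h0]
    exact DFunLike.congr_fun hy.1 (R u)

theorem mainTheorem2 {K S : Type*} [TopologicalSpace K] [CompactSpace K] [T2Space K] [Nonempty K]
    [TopologicalSpace S] [CompactSpace S] [T2Space S] :
    (∃ T : C(K, ℝ) →ₗᵢ[ℝ] C(S, ℝ), IsUEmbedding T) ↔
      ∃ h : K → S, IsEmbedding h ∧ IsGδ (Set.range h) ∧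
        ∃ T : C(K, ℝ) →L[ℝ] C(S, ℝ), IsLinearExtensionOperator h T ∧ ‖T‖ = 1 := by
  constructor
  · rintro ⟨T, hT⟩
    exact hT.exists_extensionOperator
  · rintro ⟨h, hh, hG, E, hE, hE1⟩
    exact exists_isUEmbedding_of_extensionOperator (h := ⟨h, hh.continuous⟩) hG
      (fun f k => DFunLike.congr_fun (congrFun hE k) f) hE1.le
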